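/- All graphs are finite and simple. Let $k\ge 1$ and $n\ge 2k$ be integers, and let $G=(X,Y;E)$ be a bipartite graph of order $2n-1$ with partite sets $X,Y$, where $|X|=|Y|-1$ (a nearly balanced bipartite graph; so $|X|=n-1$, $|Y|=n$). Let $\widehat G$ be its quasi-complement, i.e. the bipartite graph with the same partite sets $X,Y$ in which $x\in X$ and $y\in Y$ are adjacent if and only if $xy\notin E$, and let $\mu(\widehat G)$ be the largest eigenvalue of the adjacency matrix of $\widehat G$. Suppose that the minimum degree satisfies $\delta(G)\ge k$ and that $$\mu(\widehat G)\le\sqrt{k(n-k)}.$$ Then $G$ is traceable (that is, contains a Hamiltonian path), unless $$G\in\bigcup_{1\le j\le n/2}\mathscr C_n^{\,j}\qquad\text{or}\qquad G=\Gamma_2-v\ \text{ for some vertex } v \text{ of } \Gamma_2 \text{ with } d_{\Gamma_2}(v)=4 ,$$ where equality and membership are up to isomorphism (for $\mathscr C_n^{\,j}$, isomorphism respecting the ordered pair of partite sets), and: * For $1\le j\le n/2$, $\mathscr C_n^{\,j}$ is the family of all graphs $O_{j,n-j}\sqcup H$, where $O_{j,n-j}$ is the edgeless bipartite graph with partite sets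 of sizes $j$ and $n-j$, and $H$ is any bipartite graph with partite sets of sizes $n-j-1$ and $j$. Here, for bipartite graphs $G_1$ with partite sets $(X_1,Y_1)$ and $G_2$ with partite sets $(X_2,Y_2)$, $G_1\sqcup G_2$ is the bipartite graph with partite sets $(X_1\cup X_2,\,Y_1\cup Y_2)$ obtained from the disjoint union of $G_1$ and $G_2$ by adding all edges between $X_1$ and $Y_2$ and all edges between $Y_1$ and $X_2$. * $\Gamma_2$ is the bipartite graph with partite sets $\{x_0,x_1,x_2,x_3\}$ and $\{y_0,y_1,y_2,y_3\}$ in which $x_iy_j$ is an edge if and only if $i=0$ or $j=0$ or $i=j$. -/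

import Mathlib

namespace NearlyBalanced

/-- `G = (X, Y; E)` is a bipartite graph with partite sets `X`, `Y` (covering all vertices) and
`|X| = |Y| - 1`. -/
structure IsNearlyBalanced {V : Type*} [Fintype V] [DecidableEq V] (G : SimpleGraph V)
    (X Y : Finset V) : Prop where
  isBipartiteWith : G.IsBipartiteWith (X : Set V) (Y : Set V)
  union_eq : X ∪ Y = Finset.univ
  card_add_one : X.card + 1 = Y.card

/-- The quasi-complement of a bipartite graph `G = (X, Y; E)`: `u` and `v` are adjacent iff they
lie in different partite sets and are not adjacent in `G`. -/
def quasiComplement {V : Type*} (G : SimpleGraph V) (X Y : Finset V) : SimpleGraph V :=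
  SimpleGraph.between (X : Set V) (Y : Set V) Gᶜ

open Classical in
/-- The spectral radius `μ(G)`: the largest eigenvalue of the adjacency matrix of `G`. -/
noncomputable def mu {V : Type*} [Fintype V] (G : SimpleGraph V) : ℝ :=
  sSup (spectrum ℝ (G.adjMatrix ℝ))

open Classical in
/-- On a nonempty vertex set, `mu G` really is the largest adjacency eigenvalue. -/
theorem mu_isGreatest {V : Type*} [Fintype V] [Nonempty V] (G : SimpleGraph V) :
    IsGreatest (spectrum ℝ (G.adjMatrix ℝ)) (mu G) := by
  have hA : (G.adjMatrix ℝ).IsHermitian := by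
    simpa [Matrix.IsHermitian] using G.isSymm_adjMatrix (α := ℝ)
  have h := hA.spectrum_real_eq_range_eigenvalues
  have hfin : (spectrum ℝ (G.adjMatrix ℝ)).Finite := h ▸ Set.finite_range _
  have hne : (spectrum ℝ (G.adjMatrix ℝ)).Nonempty := h ▸ Set.range_nonempty _
  exact ⟨hne.csSup_mem hfin, fun _ hx => le_csSup hfin.bddAbove hx⟩

/-- `G` contains a Hamiltonian path. -/
def Traceable {V : Type*} [DecidableEq V] (G : SimpleGraph V) : Prop :=
  ∃ (u v : V) (p : G.Walk u v), p.IsHamiltonian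

/-- For bipartite graphs `G₁` with parts `A₁, B₁` and `G₂` with parts `A₂, B₂`, the graph
`G₁ ⊔ G₂` obtained from the disjoint union by adding all edges between `A₁` and `B₂`
and all edges between `B₁` and `A₂`. -/
def sqcup {A₁ B₁ A₂ B₂ : Type*} (G₁ : SimpleGraph (A₁ ⊕ B₁)) (G₂ : SimpleGraph (A₂ ⊕ B₂)) :
    SimpleGraph ((A₁ ⊕ B₁) ⊕ (A₂ ⊕ B₂)) :=
  SimpleGraph.sum G₁ G₂ ⊔ SimpleGraph.fromRel (fun u v =>
    (∃ a b, u = Sum.inl (Sum.inl a) ∧ v = Sum.inr (Sum.inr b)) ∨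
    (∃ b a, u = Sum.inl (Sum.inr b) ∧ v = Sum.inr (Sum.inl a)))

/-- The first partite set `A₁ ∪ A₂` of `G₁ ⊔ G₂`. -/
def firstPart (A₁ B₁ A₂ B₂ : Type*) : Set ((A₁ ⊕ B₁) ⊕ (A₂ ⊕ B₂)) :=
  {v | (∃ a, v = Sum.inl (Sum.inl a)) ∨ ∃ a, v = Sum.inr (Sum.inl a)}

/-- Membership of `G = (X, Y; E)` in the family `𝒞_n^k`: there is a bipartite graph `H` with
parts of sizes `n - k - 1` and `k` such that `G` is isomorphic, as a bipartite graph with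
ordered parts, to `O_{k, n-k} ⊔ H`. (Intended for `1 ≤ k ≤ n / 2`, where the subtractions do not
truncate.) -/
def MemC {V : Type*} (n k : ℕ) (G : SimpleGraph V) (X : Finset V) : Prop :=
  ∃ H : SimpleGraph (Fin (n - k - 1) ⊕ Fin k),
    H ≤ completeBipartiteGraph (Fin (n - k - 1)) (Fin k) ∧
    ∃ φ : G ≃g sqcup (⊥ : SimpleGraph (Fin k ⊕ Fin (n - k))) H,
      ∀ v, v ∈ X ↔ φ v ∈ firstPart (Fin k) (Fin (n - k)) (Fin (n - k - 1)) (Fin k)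

/-- The graph `Γ₂`: the balanced bipartite graph with parts `{x₀, x₁, x₂, x₃}` and
`{y₀, y₁, y₂, y₃}` in which `x₀` is adjacent to every `yⱼ`, `y₀` is adjacent to every `xᵢ`, and
`xᵢ` is adjacent to `yᵢ` for every `i`. -/
def gamma2 : SimpleGraph (Fin 4 ⊕ Fin 4) :=
  SimpleGraph.fromRel (fun u v =>
    ∃ i j : Fin 4, u = Sum.inl i ∧ v = Sum.inr j ∧ (i = 0 ∨ j = 0 ∨ i = j))

instance : DecidableRel gamma2.Adj := fun u v => by
  unfold gamma2; simp only [SimpleGraph.fromRel_adj]; infer_instance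

end NearlyBalanced

/-!
Join a new vertex to all of `Y`. This turns `G` into a balanced bipartite graph with parts of size
`n` (`extRel`) that is Hamiltonian exactly when `G` is traceable. If it is not Hamiltonian, let `R`
be an edge-maximal non-Hamiltonian bipartite graph containing it, and let `K` be the graph of
non-edges of `R` (`nonEdgeGraph`), a subgraph of the quasi-complement of `G`. By maximality a
non-adjacent pair is joined by a Hamilton path of `R`, and has degree sum at most `n`.
Together with the minimum degree of `G` this says that the two `K`-degrees at an edge of `K` have
product at least `k (n - k)`.

The spectral hypothesis turns this into an equality: for the vector `z` of square roots of
`K`-degrees, the Rayleigh quotient of the quasi-complement at `z` is at least `√(k (n - k))`, hence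
equal to it, so `z` is an eigenvector for the largest eigenvalue
(`edge_mul_degree_eq_and_eigenvector`). It follows that every edge of `K` has `K`-degrees `n - k`
in `X` and `k` in `Y`, and that no edge of the quasi-complement joins an isolated to a non-isolated
vertex of `K`.

The combinatorial core is `ncard_setOf_exists_not_adj_le`: only `k` vertices of `X` are not
isolated in `K`. Every non-adjacent pair of `R` has degree sum exactly `n`, so on a Hamilton path
between such a pair the neighbours of one end determine those of the other. The same
applies to each rotation of the path, which leaves so few possibilities for the path
that a count of neighbours finishes the proof. Hence `K` is, up to isolated vertices, a complete
bipartite graph with parts of sizes `k` and `n - k`, and `G` lies in the family `MemC n k`.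
-/

/-! ### Hamilton cycles in balanced bipartite relations -/

namespace BipartiteHamilton

variable {α β : Type*} {R : α → β → Prop} {n : ℕ} {f : ℕ → α} {g : ℕ → β}

/-- `f 0, g 0, f 1, g 1, …, f (n - 1), g (n - 1)` is a path in the bipartite graph with parts
`α`, `β` and adjacency `R`. It is a Hamilton path when both parts have `n` elements. The values
of `f` and `g` at indices `≥ n` are irrelevant. -/
structure IsHamPath (R : α → β → Prop) (n : ℕ) (f : ℕ → α) (g : ℕ → β) : Prop where
  injf : ∀ i < n, ∀ j < n, f i = f j → i = j
  injg : ∀ i < n, ∀ j < n, g i = g j → i = j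
  adj : ∀ i < n, R (f i) (g i)
  adj_succ : ∀ i, i + 1 < n → R (f (i + 1)) (g i)

/-- The path `f 0, g 0, …, f (n - 1), g (n - 1)` closes up to a cycle. -/
structure IsHamCycle (R : α → β → Prop) (n : ℕ) (f : ℕ → α) (g : ℕ → β) : Prop extends
    IsHamPath R n f g where
  closes : R (f 0) (g (n - 1))

/-- The bipartite graph with adjacency `R` has a Hamilton cycle, where `n ≥ 2` is the size
of each part. For `n = 1` a single edge counts as a cycle. -/
def Hamiltonian (R : α → β → Prop) (n : ℕ) : Prop :=
  ∃ f g, IsHamCycle R n f g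

/-- Rotation of a path along an edge from its first vertex. -/
theorem IsHamPath.rotate (h : IsHamPath R n f g) {i : ℕ} (hi : i < n) (hR : R (f 0) (g i)) :
    IsHamPath R n (fun j => if j ≤ i then f (i - j) else f j)
      (fun j => if j < i then g (i - 1 - j) else g j) where
  injf a ha b hb hab := by
    split_ifs at hab
    all_goals have := h.injf _ (by omega) _ (by omega) hab
    all_goals omega
  injg a ha b hb hab := by
    split_ifs at hab
    all_goals have := h.injg _ (by omega) _ (by omega) hab
    all_goals omega
  adj j hj := by
    split_ifs with h1 h2 h2
    · have := h.adj_succ (i - 1 - j) (by omega)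
      rwa [show i - 1 - j + 1 = i - j by omega] at this
    · obtain rfl : j = i := by omega
      simpa using hR
    · omega
    · exact h.adj j hj
  adj_succ j hj := by
    split_ifs with h1 h2 h2
    · have := h.adj (i - 1 - j) (by omega)
      rwa [show i - 1 - j = i - (j + 1) by omega] at this ⊢
    · omega
    · omega
    · exact h.adj_succ j hj

/-- The reversed path, read in the graph with the two parts exchanged. -/
theorem IsHamPath.swap (h : IsHamPath R n f g) :
    IsHamPath (fun b a => R a b) n (fun j => g (n - 1 - j)) (fun j => f (n - 1 - j)) where
  injf a ha b hb hab := by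
    have := h.injg _ (by omega) _ (by omega) hab
    omega
  injg a ha b hb hab := by
    have := h.injf _ (by omega) _ (by omega) hab
    omega
  adj j hj := h.adj _ (by omega)
  adj_succ j hj := by
    have := h.adj_succ (n - 1 - (j + 1)) (by omega)
    rwa [show n - 1 - (j + 1) + 1 = n - 1 - j by omega] at this

theorem Hamiltonian.swap (h : Hamiltonian R n) : Hamiltonian (fun b a => R a b) n := by
  obtain ⟨f, g, h⟩ := h
  refine ⟨_, _, h.toIsHamPath.swap, ?_⟩
  simpa using h.closes

/-- A Hamilton cycle can be traversed starting with the edge `f i`, `g (i - 1)`, so that `f i`,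
`g i` becomes the closing edge. -/
theorem IsHamCycle.reverse_from (h : IsHamCycle R n f g) {i : ℕ} (hi : i < n) :
    ∃ f' g', IsHamCycle R n f' g' ∧ f' 0 = f i ∧ g' (n - 1) = g i := by
  refine ⟨fun j => if j ≤ i then f (i - j) else f (n + i - j),
    fun j => if j < i then g (i - 1 - j) else g (n + i - 1 - j), ⟨⟨?_, ?_, ?_, ?_⟩, ?_⟩, ?_, ?_⟩
  · intro a ha b hb hab
    split_ifs at hab
    all_goals have := h.injf _ (by omega) _ (by omega) hab
    all_goals omega
  · intro a ha b hb hab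
    split_ifs at hab
    all_goals have := h.injg _ (by omega) _ (by omega) hab
    all_goals omega
  · intro j hj
    split_ifs with h1 h2 h2
    · have := h.adj_succ (i - 1 - j) (by omega)
      rwa [show i - 1 - j + 1 = i - j by omega] at this
    · obtain rfl : j = i := by omega
      simpa [show n + j - 1 - j = n - 1 by omega] using h.closes
    · omega
    · have := h.adj_succ (n + i - 1 - j) (by omega)
      rwa [show n + i - 1 - j + 1 = n + i - j by omega] at this
  · intro j hj
    split_ifs with h1 h2 h2
    · have := h.adj (i - 1 - j) (by omega)
      rwa [show i - 1 - j = i - (j + 1) by omega] at this ⊢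
    · omega
    · omega
    · have := h.adj (n + i - 1 - j) (by omega)
      rwa [show n + i - 1 - j = n + i - (j + 1) by omega] at this ⊢
  · have := h.adj i hi
    simpa [show ¬ n - 1 < i by omega, show n + i - 1 - (n - 1) = i by omega] using this
  · simp
  · simp [show ¬ n - 1 < i by omega, show n + i - 1 - (n - 1) = i by omega]

/-- A Hamilton cycle can be traversed starting at `f (i + 1)`, so that `f (i + 1)`, `g i` becomes
the closing edge. -/
theorem IsHamCycle.shift_to (h : IsHamCycle R n f g) {i : ℕ} (hi : i + 1 < n) :
    ∃ f' g', IsHamCycle R n f' g' ∧ f' 0 = f (i + 1) ∧ g' (n - 1) = g i := by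
  refine ⟨fun j => if j + i + 1 < n then f (j + i + 1) else f (j + i + 1 - n),
    fun j => if j + i + 1 < n then g (j + i + 1) else g (j + i + 1 - n),
    ⟨⟨?_, ?_, ?_, ?_⟩, ?_⟩, ?_, ?_⟩
  · intro a ha b hb hab
    split_ifs at hab
    all_goals have := h.injf _ (by omega) _ (by omega) hab
    all_goals omega
  · intro a ha b hb hab
    split_ifs at hab
    all_goals have := h.injg _ (by omega) _ (by omega) hab
    all_goals omega
  · intro j hj
    split_ifs with h1
    · exact h.adj _ h1
    · exact h.adj _ (by omega)
  · intro j hj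
    split_ifs with h1 h2 h2
    · have := h.adj_succ (j + i + 1) (by omega)
      rwa [show j + i + 1 + 1 = j + 1 + i + 1 by omega] at this
    · omega
    · rw [show j + 1 + i + 1 - n = 0 by omega, show j + i + 1 = n - 1 by omega]
      exact h.closes
    · have := h.adj_succ (j + i + 1 - n) (by omega)
      rwa [show j + i + 1 - n + 1 = j + 1 + i + 1 - n by omega] at this
  · have := h.adj_succ i hi
    simpa [hi, show ¬ n - 1 + i + 1 < n by omega, show n - 1 + i + 1 - n = i by omega] using this
  · simp [hi]
  · simp [show ¬ n - 1 + i + 1 < n by omega, show n - 1 + i + 1 - n = i by omega]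

/-- In an edge-maximal non-Hamiltonian bipartite graph, any two non-adjacent vertices of different
parts are the ends of a Hamilton path. -/
theorem exists_isHamPath_of_maximal (hn : 2 ≤ n)
    (hmax : Maximal (fun S : α → β → Prop => ¬ Hamiltonian S n) R) {a : α} {b : β}
    (hab : ¬ R a b) : ∃ f g, IsHamPath R n f g ∧ f 0 = a ∧ g (n - 1) = b := by
  let S : α → β → Prop := fun x y => R x y ∨ (x = a ∧ y = b)
  have hRS : R ≤ S := fun x y h => Or.inl h
  have hS : Hamiltonian S n := by
    by_contra hS
    exact hab (hmax.2 hS hRS a b (Or.inr ⟨rfl, rfl⟩))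
  obtain ⟨f, g, hfg⟩ := hS
  -- it suffices to traverse the cycle so that the new edge is the closing one
  suffices ∃ f g, IsHamCycle S n f g ∧ f 0 = a ∧ g (n - 1) = b by
    obtain ⟨f, g, h, ha, hb⟩ := this
    refine ⟨f, g, ⟨h.injf, h.injg, fun i hi => ?_, fun i hi => ?_⟩, ha, hb⟩
    · rcases h.adj i hi with h1 | ⟨h1, h2⟩
      · exact h1
      · have := h.injf i hi 0 (by omega) (h1.trans ha.symm)
        have := h.injg i hi (n - 1) (by omega) (h2.trans hb.symm)
        omega
    · rcases h.adj_succ i hi with h1 | ⟨h1, h2⟩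
      · exact h1
      · have := h.injf (i + 1) hi 0 (by omega) (h1.trans ha.symm)
        omega
  by_cases h1 : ∃ i < n, f i = a ∧ g i = b
  · obtain ⟨i, hi, ha, hb⟩ := h1
    obtain ⟨f', g', h', ha', hb'⟩ := hfg.reverse_from hi
    exact ⟨f', g', h', ha'.trans ha, hb'.trans hb⟩
  by_cases h2 : ∃ i, i + 1 < n ∧ f (i + 1) = a ∧ g i = b
  · obtain ⟨i, hi, ha, hb⟩ := h2
    obtain ⟨f', g', h', ha', hb'⟩ := hfg.shift_to hi
    exact ⟨f', g', h', ha'.trans ha, hb'.trans hb⟩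
  by_cases h3 : f 0 = a ∧ g (n - 1) = b
  · exact ⟨f, g, hfg, h3⟩
  refine absurd ⟨f, g, ⟨hfg.injf, hfg.injg, fun i hi => ?_, fun i hi => ?_⟩, ?_⟩ hmax.1
  · exact (hfg.adj i hi).resolve_right fun h => h1 ⟨i, hi, h⟩
  · exact (hfg.adj_succ i hi).resolve_right fun h => h2 ⟨i, hi, h⟩
  · exact hfg.closes.resolve_right h3

/-- Vertices of a part can be counted by their positions on a Hamilton path. -/
theorem ncard_setOf_eq [Finite β] (hβ : Nat.card β = n)
    (hg : ∀ i < n, ∀ j < n, g i = g j → i = j) (P : β → Prop) :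
    {b | P b}.ncard = {i | i < n ∧ P (g i)}.ncard := by
  have hinj : Set.InjOn g (Set.Iio n) := fun i hi j hj h => hg i hi j hj h
  have himg : g '' Set.Iio n = Set.univ := by
    apply Set.eq_of_subset_of_ncard_le (Set.subset_univ _)
    rw [Set.ncard_univ, hβ, Set.InjOn.ncard_image hinj]
    simp
  have h2 : {b | P b} = g '' {i | i < n ∧ P (g i)} := by
    ext b
    constructor
    · intro hb
      obtain ⟨i, hi, rfl⟩ : b ∈ g '' Set.Iio n := himg ▸ Set.mem_univ b
      exact ⟨i, ⟨hi, hb⟩, rfl⟩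
    · rintro ⟨i, hi, rfl⟩
      exact hi.2
  rw [h2, Set.InjOn.ncard_image (hinj.mono fun i hi => hi.1)]

theorem finite_setOf_lt_and (n : ℕ) (P : ℕ → Prop) : {i | i < n ∧ P i}.Finite :=
  (Set.finite_Iio n).subset fun _ h => h.1

theorem ncard_add_ncard_not (n : ℕ) (P : ℕ → Prop) :
    {i | i < n ∧ P i}.ncard + {i | i < n ∧ ¬ P i}.ncard = n := by
  rw [← Set.ncard_union_eq _ (finite_setOf_lt_and n P) (finite_setOf_lt_and n _)]
  · have : {i | i < n ∧ P i} ∪ {i | i < n ∧ ¬ P i} = Set.Iio n := by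
      ext i
      simp only [Set.mem_union, Set.mem_ofPred_eq, Set.mem_Iio]
      tauto
    rw [this]
    simp
  · rw [Set.disjoint_left]
    rintro i ⟨-, h⟩ ⟨-, h'⟩
    exact h' h

/-- In a non-Hamiltonian graph, an edge from the first vertex and an edge from the last vertex of
a Hamilton path do not cross. -/
theorem IsHamPath.not_adj_last (h : IsHamPath R n f g) (hR : ¬ Hamiltonian R n) {i : ℕ}
    (hi : i < n) (h0 : R (f 0) (g i)) : ¬ R (f i) (g (n - 1)) := by
  intro hl
  refine hR ⟨_, _, h.rotate hi h0, ?_⟩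
  simpa [show ¬ n - 1 < i by omega] using hl

theorem IsHamPath.ncard_add_ncard_le [Finite α] [Finite β] (hα : Nat.card α = n)
    (hβ : Nat.card β = n) (h : IsHamPath R n f g) (hR : ¬ Hamiltonian R n) :
    {b | R (f 0) b}.ncard + {a | R a (g (n - 1))}.ncard ≤ n := by
  rw [ncard_setOf_eq hβ h.injg, ncard_setOf_eq hα h.injf]
  have h1 := ncard_add_ncard_not n (fun i => R (f 0) (g i))
  have h2 : {i | i < n ∧ R (f i) (g (n - 1))}.ncard ≤ {i | i < n ∧ ¬ R (f 0) (g i)}.ncard :=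
    Set.ncard_le_ncard (fun i hi => ⟨hi.1, fun h' => h.not_adj_last hR hi.1 h' hi.2⟩)
      (finite_setOf_lt_and n _)
  omega

theorem IsHamPath.adj_last_iff [Finite α] [Finite β] (hα : Nat.card α = n)
    (hβ : Nat.card β = n) (h : IsHamPath R n f g) (hR : ¬ Hamiltonian R n)
    (hdeg : {b | R (f 0) b}.ncard + {a | R a (g (n - 1))}.ncard = n) {i : ℕ} (hi : i < n) :
    R (f i) (g (n - 1)) ↔ ¬ R (f 0) (g i) := by
  rw [ncard_setOf_eq hβ h.injg, ncard_setOf_eq hα h.injf] at hdeg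
  have h1 := ncard_add_ncard_not n (fun i => R (f 0) (g i))
  have h2 : {i | i < n ∧ R (f i) (g (n - 1))} = {i | i < n ∧ ¬ R (f 0) (g i)} := by
    refine Set.eq_of_subset_of_ncard_le
      (fun i hi => ⟨hi.1, fun h' => h.not_adj_last hR hi.1 h' hi.2⟩) ?_ (finite_setOf_lt_and n _)
    omega
  have := Set.ext_iff.1 h2 i
  simpa [hi] using this

/-- If all non-adjacent pairs have degree sum exactly `n`, rotating a Hamilton path along the edge
from `f 0` to `g i` determines the neighbours of `f i`. -/
theorem IsHamPath.adj_iff_of_adj_first [Finite α] [Finite β] (hα : Nat.card α = n)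
    (hβ : Nat.card β = n) (h : IsHamPath R n f g) (hR : ¬ Hamiltonian R n)
    (hdeg : ∀ a b, ¬ R a b → {b' | R a b'}.ncard + {a' | R a' b}.ncard = n) {i : ℕ} (hi : i < n)
    (h0 : R (f 0) (g i)) :
    (∀ l < i, (R (f i) (g l) ↔ ¬ R (f (l + 1)) (g (n - 1)))) ∧
    (∀ l, i < l → l < n → (R (f i) (g l) ↔ ¬ R (f l) (g (n - 1)))) := by
  have hrot := h.rotate hi h0
  have hlast : ¬ n - 1 < i := by omega
  have key : ∀ j < n, _ := fun j hj => hrot.adj_last_iff hα hβ hR (i := j)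
    (hdeg _ _ (by simpa [hlast] using h.not_adj_last hR hi h0)) hj
  simp only [hlast, if_false, zero_le, if_true, Nat.sub_zero] at key
  constructor
  · intro l hl
    have := key (i - 1 - l) (by omega)
    rw [if_pos (by omega), if_pos (by omega), show i - (i - 1 - l) = l + 1 by omega,
      show i - 1 - (i - 1 - l) = l by omega] at this
    tauto
  · intro l hil hl
    have := key l hl
    rw [if_neg (by omega), if_neg (by omega)] at this
    tauto

/-- In an edge-maximal non-Hamiltonian bipartite graph with parts of size `n` the degree sum of a
non-adjacent pair is at most `n`. -/
theorem ncard_add_ncard_le_of_maximal [Finite α] [Finite β] (hn : 2 ≤ n) (hα : Nat.card α = n)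
    (hβ : Nat.card β = n) (hmax : Maximal (fun S : α → β → Prop => ¬ Hamiltonian S n) R) {a : α}
    {b : β} (hab : ¬ R a b) : {b' | R a b'}.ncard + {a' | R a' b}.ncard ≤ n := by
  obtain ⟨f, g, h, rfl, rfl⟩ := exists_isHamPath_of_maximal hn hmax hab
  exact h.ncard_add_ncard_le hα hβ hmax.1

/-- Suppose that a bipartite graph with parts of size `n > 2k` is edge-maximal non-Hamiltonian and
that every non-adjacent pair `a`, `b` has degrees `k` and `n - k`. Then at most `k` vertices of
the first part have a non-neighbour in the second part. -/
theorem ncard_setOf_exists_not_adj_le [Finite α] [Finite β] {k : ℕ} (hn : 2 ≤ n) (hkn : 2 * k < n)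
    (hα : Nat.card α = n) (hβ : Nat.card β = n)
    (hmax : Maximal (fun S : α → β → Prop => ¬ Hamiltonian S n) R)
    (hdeg : ∀ a b, ¬ R a b → {b' | R a b'}.ncard = k ∧ {a' | R a' b}.ncard = n - k) :
    {a | ∃ b, ¬ R a b}.ncard ≤ k := by
  rcases Set.eq_empty_or_nonempty {a | ∃ b, ¬ R a b} with he | ⟨a, b, hab⟩
  · simp [he]
  obtain ⟨f, g, h, rfl, rfl⟩ := exists_isHamPath_of_maximal hn hmax hab
  have hsum : ∀ a b, ¬ R a b → {b' | R a b'}.ncard + {a' | R a' b}.ncard = n := by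
    intro a b hab
    obtain ⟨h1, h2⟩ := hdeg a b hab
    omega
  have hlast := fun i (hi : i < n) => h.adj_last_iff hα hβ hmax.1 (hsum _ _ hab) hi
  set A : ℕ → Prop := fun i => R (f 0) (g i) with hA
  change ∀ i < n, (R (f i) (g (n - 1)) ↔ ¬ A i) at hlast
  change ¬ A (n - 1) at hab
  have hcardA : {i | i < n ∧ A i}.ncard = k := by
    rw [← (hdeg _ _ hab).1, ncard_setOf_eq hβ h.injg]
  have hcardN : {i | i < n ∧ ¬ A i}.ncard = n - k := by
    have := ncard_add_ncard_not n A
    omega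
  have hA0 : A 0 := h.adj 0 (by omega)
  -- rotation at the first vertex
  have hx : ∀ i < n, A i → ∀ l < i, (R (f i) (g l) ↔ A (l + 1)) := by
    intro i hi hAi l hl
    rw [(h.adj_iff_of_adj_first hα hβ hmax.1 hsum hi hAi).1 l hl, hlast _ (by omega), not_not]
  -- rotation at the last vertex
  have hrev : ∀ l < n, ¬ A l → (∀ i, l < i → i < n → (R (f i) (g l) ↔ ¬ A (i - 1))) ∧
      (∀ i < l, (R (f i) (g l) ↔ ¬ A i)) := by
    intro l hl hAl
    have hs := h.swap.adj_iff_of_adj_first hβ hα (fun h' => hmax.1 h'.swap)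
      (fun b a hab => by rw [add_comm]; exact hsum a b hab) (i := n - 1 - l) (by omega)
      (by simpa [show n - 1 - (n - 1 - l) = l by omega] using (hlast l hl).2 hAl)
    simp only [show n - 1 - (n - 1 - l) = l by omega, Nat.sub_self] at hs
    constructor
    · intro i hli hi
      have := hs.1 (n - 1 - i) (by omega)
      rwa [show n - 1 - (n - 1 - i) = i by omega,
        show n - 1 - (n - 1 - i + 1) = i - 1 by omega] at this
    · intro i hil
      have := hs.2 (n - 1 - i) (by omega) (by omega)
      rwa [show n - 1 - (n - 1 - i) = i by omega] at this
  by_cases hcase : ∃ l i, l < i ∧ i < n ∧ ¬ A l ∧ A i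
  · exfalso
    classical
    have hexN : ∃ l, ¬ A l := ⟨n - 1, hab⟩
    obtain ⟨l, hAl, hlmin⟩ : ∃ l, ¬ A l ∧ ∀ m < l, A m :=
      ⟨Nat.find hexN, Nat.find_spec hexN, fun m hm => not_not.1 (Nat.find_min hexN hm)⟩
    have hexA : ∃ i, l < i ∧ i < n ∧ A i := by
      obtain ⟨l', i, hli, hi, hAl', hAi⟩ := hcase
      have : l ≤ l' := by
        by_contra hlt
        exact hAl' (hlmin l' (by omega))
      exact ⟨i, by omega, hi, hAi⟩
    obtain ⟨i, ⟨hli, hi, hAi⟩, himin⟩ : ∃ i, (l < i ∧ i < n ∧ A i) ∧ ¬ A (i - 1) := by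
      refine ⟨Nat.find hexA, Nat.find_spec hexA, fun hA' => ?_⟩
      obtain ⟨h1, h2, h3⟩ := Nat.find_spec hexA
      have h4 : l ≠ Nat.find hexA - 1 := fun he => hAl (he ▸ hA')
      exact Nat.find_min hexA (m := Nat.find hexA - 1) (by omega) ⟨by omega, by omega, hA'⟩
    have hl : l < n := by omega
    -- comparing both rotations at `f i`, `g l` shows that `l` is directly followed by an index
    -- in `A`
    have hA1 : A (l + 1) := (hx i hi hAi l hli).1 (((hrev l hl hAl).1 i hli hi).2 himin)
    have hl2 : l + 2 < n := by
      have : l + 1 ≠ n - 1 := fun he => hab (he ▸ hA1)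
      omega
    have hnadj : ¬ R (f (l + 2)) (g l) := fun hr =>
      ((hrev l hl hAl).1 (l + 2) (by omega) hl2).1 hr hA1
    have hA2 : ¬ A (l + 2) := fun hA2 => hnadj ((hx (l + 2) hl2 hA2 l (by omega)).2 hA1)
    -- `f (l + 2)` misses only `g l` among the `n - k` vertices `g m` with `¬ A m`, and it is
    -- adjacent to `g (l + 1)`
    have hsub : insert (l + 1) ({i | i < n ∧ ¬ A i} \ {l}) ⊆
        {m | m < n ∧ R (f (l + 2)) (g m)} := by
      rintro m (rfl | ⟨⟨hm, hAm⟩, hml⟩)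
      · exact ⟨by omega, h.adj_succ (l + 1) hl2⟩
      · have hml : m ≠ l := hml
        have h1 : ¬ m < l := fun hlt => hAm (hlmin m hlt)
        have h2 : m ≠ l + 1 := fun he => hAm (he ▸ hA1)
        refine ⟨hm, ?_⟩
        rcases eq_or_ne m (l + 2) with rfl | h3
        · exact h.adj _ hm
        · exact ((hrev m hm hAm).2 (l + 2) (by omega)).2 hA2
    have hle := Set.ncard_le_ncard hsub (finite_setOf_lt_and n _)
    rw [Set.ncard_insert_of_notMem (by simp [hA1])
      ((finite_setOf_lt_and n _).subset Set.sdiff_subset),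
      Set.ncard_sdiff_singleton_of_mem (show l ∈ {i | i < n ∧ ¬ A i} from ⟨hl, hAl⟩), hcardN,
      ← ncard_setOf_eq hβ h.injg (fun b => R (f (l + 2)) b), (hdeg _ _ hnadj).1] at hle
    omega
  · push Not at hcase
    rw [ncard_setOf_eq hα h.injf, ← hcardA]
    refine Set.ncard_le_ncard ?_ (finite_setOf_lt_and n _)
    rintro i ⟨hi, b, hib⟩
    refine ⟨hi, ?_⟩
    by_contra hAi
    have hsub : {l | l < n ∧ ¬ A l} ⊆ {l | l < n ∧ R (f i) (g l)} := by
      rintro l ⟨hl, hAl⟩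
      refine ⟨hl, ?_⟩
      rcases lt_trichotomy i l with hil | rfl | hli
      · exact ((hrev l hl hAl).2 i hil).2 hAi
      · exact h.adj _ hl
      · refine ((hrev l hl hAl).1 i hli hi).2 fun hA' => ?_
        rcases eq_or_ne l (i - 1) with rfl | hne
        · exact hAl hA'
        · exact hcase l (i - 1) (by omega) (by omega) hAl hA'
    have hle := Set.ncard_le_ncard hsub (finite_setOf_lt_and n _)
    rw [hcardN, ← ncard_setOf_eq hβ h.injg (fun b => R (f i) b), (hdeg _ _ hib).1] at hle
    omega

end BipartiteHamilton

/-! ### The spectral radius against the degrees of a subgraph -/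

namespace NearlyBalanced

open Classical in
theorem posSemidef_sub_adjMatrix {V : Type*} [Fintype V] {G : SimpleGraph V} {r : ℝ}
    (h : mu G ≤ r) : (algebraMap ℝ (Matrix V V ℝ) r - G.adjMatrix ℝ).PosSemidef := by
  have hA : (G.adjMatrix ℝ).IsHermitian := by
    simp [Matrix.IsHermitian]
  have hr : (algebraMap ℝ (Matrix V V ℝ) r).IsHermitian := by
    rw [Matrix.algebraMap_eq_diagonal]
    exact Matrix.isHermitian_diagonal _
  refine Matrix.posSemidef_iff_isHermitian_and_spectrum_nonneg.2 ⟨hr.sub hA, fun x hx => ?_⟩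
  rw [← spectrum.singleton_sub_eq] at hx
  obtain ⟨_, hr', m, hm, rfl⟩ := Set.mem_sub.1 hx
  rw [Set.mem_singleton_iff.1 hr']
  have : Nonempty V := by
    by_contra hV
    rw [not_nonempty_iff] at hV
    simp [spectrum.of_subsingleton] at hm
  have := (mu_isGreatest G).2 hm
  change 0 ≤ r - m
  linarith

open Classical in
/-- Let `K ≤ L` be graphs such that the product of the `K`-degrees of the ends of each edge of `K`
is at least `r ^ 2`, where `r ≥ μ(L)`. Then the vector of square roots of the `K`-degrees is an
eigenvector of `L` for `r`. Its Rayleigh quotient is already at least `r` when only the edges of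
`K` are counted. -/
theorem edge_mul_degree_eq_and_eigenvector {V : Type*} [Fintype V] {K L : SimpleGraph V}
    (hKL : K ≤ L) {r : ℝ} (hmu : mu L ≤ r)
    (hdeg : ∀ u v, K.Adj u v → r ≤ √(K.degree u) * √(K.degree v)) :
    (∀ u v, K.Adj u v → √(K.degree u) * √(K.degree v) = r) ∧
      ∀ u, ∑ v ∈ L.neighborFinset u, √(K.degree v) = r * √(K.degree u) := by
  set z : V → ℝ := fun v => √(K.degree v) with hz
  have hz0 : ∀ v, 0 ≤ z v := fun v => Real.sqrt_nonneg _
  have hpsd := posSemidef_sub_adjMatrix hmu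
  have hLz : ∀ u, (L.adjMatrix ℝ).mulVec z u = ∑ v, if L.Adj u v then z v else 0 := by
    intro u
    simp [Matrix.mulVec, dotProduct, SimpleGraph.adjMatrix_apply]
  have hquad : star z ⬝ᵥ (algebraMap ℝ (Matrix V V ℝ) r - L.adjMatrix ℝ).mulVec z =
      ∑ u, ∑ v, ((if K.Adj u v then r else 0) - if L.Adj u v then z u * z v else 0) := by
    simp only [dotProduct, Matrix.sub_mulVec, Pi.sub_apply, hLz, Algebra.algebraMap_eq_smul_one,
      Matrix.smul_mulVec, Matrix.one_mulVec, Pi.smul_apply, smul_eq_mul, Pi.star_apply,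
      star_trivial]
    refine Finset.sum_congr rfl fun u _ => ?_
    rw [mul_sub, Finset.sum_sub_distrib, Finset.mul_sum]
    congr 1
    · have : z u * z u = K.degree u := Real.mul_self_sqrt (by positivity)
      rw [mul_left_comm, this, Finset.sum_ite, Finset.sum_const_zero, Finset.sum_const, add_zero,
        ← SimpleGraph.neighborFinset_eq_filter, SimpleGraph.card_neighborFinset_eq_degree,
        nsmul_eq_mul, mul_comm]
    · exact Finset.sum_congr rfl fun v _ => by split_ifs <;> simp
  have hterm : ∀ u v,
      ((if K.Adj u v then r else 0) - if L.Adj u v then z u * z v else 0) ≤ 0 := by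
    intro u v
    by_cases hK : K.Adj u v
    · simpa [hK, hKL hK] using hdeg u v hK
    · have := mul_nonneg (hz0 u) (hz0 v)
      by_cases hL : L.Adj u v <;> simp [hK, hL, this]
  have hsum : ∑ u, ∑ v,
      ((if K.Adj u v then r else 0) - if L.Adj u v then z u * z v else 0) = 0 :=
    le_antisymm (Finset.sum_nonpos fun u _ => Finset.sum_nonpos fun v _ => hterm u v)
      (hquad ▸ hpsd.dotProduct_mulVec_nonneg z)
  constructor
  · intro u v huv
    rw [Finset.sum_eq_zero_iff_of_nonpos
      fun u _ => Finset.sum_nonpos fun v _ => hterm u v] at hsum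
    have h1 := hsum u (Finset.mem_univ u)
    rw [Finset.sum_eq_zero_iff_of_nonpos fun v _ => hterm u v] at h1
    have h2 := h1 v (Finset.mem_univ v)
    simp only [huv, hKL huv, if_true] at h2
    linarith
  · intro u
    have h1 := congr_fun ((hpsd.dotProduct_mulVec_zero_iff z).1 (hquad.trans hsum)) u
    simp only [Matrix.sub_mulVec, Pi.sub_apply, hLz, Algebra.algebraMap_eq_smul_one,
      Matrix.smul_mulVec, Matrix.one_mulVec, Pi.smul_apply, smul_eq_mul, Pi.zero_apply] at h1
    rw [SimpleGraph.neighborFinset_eq_filter, Finset.sum_filter]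
    linarith

open Classical in
/-- Let `K ≤ L` be graphs such that the product of the `K`-degrees of the ends of each edge of `K`
is at least `r ^ 2`, where `r ≥ μ(L)`. Then these products are all equal to `r ^ 2`, and no edge
of `L` joins an isolated to a non-isolated vertex of `K`. -/
theorem degree_mul_degree_of_mu_le {V : Type*} [Fintype V] {K L : SimpleGraph V} (hKL : K ≤ L)
    {r : ℝ} (hmu : mu L ≤ r)
    (hdeg : ∀ u v, K.Adj u v → r ^ 2 ≤ K.degree u * K.degree v) :
    (∀ u v, K.Adj u v → (K.degree u * K.degree v : ℝ) = r ^ 2) ∧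
      ∀ u v, L.Adj u v → K.degree u = 0 → K.degree v = 0 := by
  obtain ⟨h1, h2⟩ := edge_mul_degree_eq_and_eigenvector hKL hmu fun u v huv => by
    rw [← Real.sqrt_mul (by positivity)]
    exact Real.le_sqrt_of_sq_le (hdeg u v huv)
  constructor
  · intro u v huv
    rw [← h1 u v huv, mul_pow, Real.sq_sqrt (by positivity), Real.sq_sqrt (by positivity)]
  · intro u v huv hu
    have h3 := h2 u
    rw [hu, Nat.cast_zero, Real.sqrt_zero, mul_zero,
      Finset.sum_eq_zero_iff_of_nonneg fun _ _ => Real.sqrt_nonneg _] at h3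
    have h4 := h3 v (by simpa using huv)
    rw [Real.sqrt_eq_zero (by positivity)] at h4
    exact_mod_cast h4

end NearlyBalanced

/-! ### Traceability and the balanced extension -/

namespace NearlyBalanced

open BipartiteHamilton

/-- The balanced extension of `G = (X, Y; E)`: adjacency between `X` with one extra vertex `none`,
joined to every vertex of `Y`, and `Y`. -/
def extRel {V : Type*} (G : SimpleGraph V) (X Y : Finset V) (a : Option X) (b : Y) : Prop :=
  ∀ x ∈ a, G.Adj x b

theorem exists_walk_support_eq {V : Type*} {G : SimpleGraph V} (w : ℕ → V) (m : ℕ)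
    (h : ∀ i < m, G.Adj (w i) (w (i + 1))) :
    ∃ p : G.Walk (w 0) (w m), p.support = (List.range (m + 1)).map w := by
  induction m with
  | zero => exact ⟨.nil, by simp⟩
  | succ m ih =>
    obtain ⟨p, hp⟩ := ih fun i hi => h i (by omega)
    refine ⟨p.concat (h m (by omega)), ?_⟩
    rw [SimpleGraph.Walk.support_concat, hp, List.range_succ (n := m + 1)]
    simp

variable {V : Type*} [Fintype V] [DecidableEq V] {G : SimpleGraph V} {X Y : Finset V} {n : ℕ}

theorem traceable_of_seq (w : ℕ → V) (m : ℕ) (hm : Fintype.card V = m + 1)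
    (hadj : ∀ i < m, G.Adj (w i) (w (i + 1)))
    (hinj : ∀ i ≤ m, ∀ j ≤ m, w i = w j → i = j) : Traceable G := by
  obtain ⟨p, hp⟩ := exists_walk_support_eq w m hadj
  refine ⟨_, _, p, SimpleGraph.Walk.isHamiltonian_iff_isPath_and_length_eq.2 ⟨?_, ?_⟩⟩
  · rw [SimpleGraph.Walk.isPath_def, hp]
    refine List.Nodup.map_on (fun i hi j hj => ?_) List.nodup_range
    rw [List.mem_range] at hi hj
    exact hinj i (by omega) j (by omega)
  · have := congr_arg List.length hp
    simp only [SimpleGraph.Walk.length_support, List.length_map, List.length_range] at this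
    omega

theorem IsNearlyBalanced.disjoint (hG : IsNearlyBalanced G X Y) : Disjoint X Y :=
  Finset.disjoint_coe.1 hG.isBipartiteWith.disjoint

theorem IsNearlyBalanced.mem_or_mem (hG : IsNearlyBalanced G X Y) (v : V) : v ∈ X ∨ v ∈ Y := by
  rw [← Finset.mem_union, hG.union_eq]
  exact Finset.mem_univ v

theorem IsNearlyBalanced.card_left (hG : IsNearlyBalanced G X Y)
    (hcard : Fintype.card V = 2 * n - 1) : X.card + 1 = n := by
  have h1 := Finset.card_union_of_disjoint hG.disjoint
  rw [hG.union_eq, Finset.card_univ] at h1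
  have := hG.card_add_one
  omega

/-- Deleting the extra vertex from a Hamilton cycle of the balanced extension leaves a Hamilton
path of `G`. -/
theorem IsNearlyBalanced.traceable (hG : IsNearlyBalanced G X Y)
    (hcard : Fintype.card V = 2 * n - 1) (h : Hamiltonian (extRel G X Y) n) : Traceable G := by
  have hX := hG.card_left hcard
  have hY := hG.card_add_one
  obtain ⟨f₀, g₀, h₀⟩ := h
  obtain ⟨i, hi, hi'⟩ : ∃ i < n, f₀ i = none := by
    have hone := ncard_setOf_eq (n := n) (by simp [hX]) h₀.injf (· = none)
    have h1 : {b : Option X | b = none}.ncard = 1 := by simp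
    rw [h1] at hone
    obtain ⟨i, hi⟩ := Set.ncard_eq_one.1 hone.symm
    have : i ∈ {i | i < n ∧ f₀ i = none} := hi ▸ Set.mem_singleton i
    exact ⟨i, this⟩
  obtain ⟨f, g, h, hf0, -⟩ := h₀.reverse_from hi
  rw [hi'] at hf0
  have hsome : ∀ j, 0 < j → j < n → ∃ x : X, f j = some x := by
    intro j hj hjn
    refine Option.ne_none_iff_exists'.1 fun hj' => ?_
    have := h.injf j hjn 0 (by omega) (hj'.trans hf0.symm)
    omega
  -- the values of `f` as vertices; only the indices `0 < j < n` matter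
  set ξ : ℕ → V := fun j => ((f j).map Subtype.val).getD (g 0) with hξ
  have hξ' : ∀ j, 0 < j → j < n → ∃ x : X, f j = some x ∧ ξ j = x := by
    intro j hj hjn
    obtain ⟨x, hx⟩ := hsome j hj hjn
    exact ⟨x, hx, by simp [hξ, hx]⟩
  set w : ℕ → V := fun m => if m % 2 = 0 then (g (m / 2) : V) else ξ (m / 2 + 1) with hw
  have hdisj : ∀ x : X, ∀ y : Y, (x : V) ≠ y := fun x y hxy =>
    Finset.disjoint_left.1 hG.disjoint x.2 (hxy ▸ y.2)
  refine traceable_of_seq w (2 * n - 2) (by omega) (fun m hm => ?_) (fun a ha b hb hab => ?_)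
  · rcases Nat.mod_two_eq_zero_or_one m with h0 | h1
    · obtain ⟨x, hx, hx'⟩ := hξ' (m / 2 + 1) (by omega) (by omega)
      have := h.adj_succ (m / 2) (by omega) x hx
      simp only [hw, h0, if_true, show ¬ (m + 1) % 2 = 0 by omega, if_false,
        show (m + 1) / 2 = m / 2 by omega, hx']
      exact this.symm
    · obtain ⟨x, hx, hx'⟩ := hξ' (m / 2 + 1) (by omega) (by omega)
      have := h.adj (m / 2 + 1) (by omega) x hx
      simpa [hw, h1, show (m + 1) % 2 = 0 by omega, show (m + 1) / 2 = m / 2 + 1 by omega, hx']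
        using this
  · simp only [hw] at hab
    split_ifs at hab with h1 h2 h2
    · have := h.injg _ (by omega) _ (by omega) (Subtype.ext hab)
      omega
    · obtain ⟨x, hx, hx'⟩ := hξ' (b / 2 + 1) (by omega) (by omega)
      exact absurd (hx'.symm.trans hab.symm) (hdisj _ _)
    · obtain ⟨x, hx, hx'⟩ := hξ' (a / 2 + 1) (by omega) (by omega)
      exact absurd (hx'.symm.trans hab) (hdisj _ _)
    · obtain ⟨x, hx, hx'⟩ := hξ' (a / 2 + 1) (by omega) (by omega)
      obtain ⟨y, hy, hy'⟩ := hξ' (b / 2 + 1) (by omega) (by omega)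
      have hxy : x = y := Subtype.ext (hx'.symm.trans (hab.trans hy'))
      have := h.injf _ (by omega) _ (by omega) (hx.trans ((congr_arg some hxy).trans hy.symm))
      omega

theorem hamiltonian_of_forall {α β : Type*} [Finite α] [Finite β] {R : α → β → Prop} (hn : 0 < n)
    (hα : Nat.card α = n) (hβ : Nat.card β = n) (hR : ∀ a b, R a b) : Hamiltonian R n := by
  let e := Finite.equivFinOfCardEq hα
  let e' := Finite.equivFinOfCardEq hβ
  refine ⟨fun i => e.symm ⟨i % n, Nat.mod_lt _ hn⟩, fun i => e'.symm ⟨i % n, Nat.mod_lt _ hn⟩,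
    ⟨⟨fun i hi j hj hij => ?_, fun i hi j hj hij => ?_, fun _ _ => hR _ _, fun _ _ => hR _ _⟩,
      hR _ _⟩⟩
  · simpa [Nat.mod_eq_of_lt, hi, hj] using hij
  · simpa [Nat.mod_eq_of_lt, hi, hj] using hij

/-! ### Recognizing the exceptional family -/

theorem memC_of_subsets {k : ℕ} (hG : IsNearlyBalanced G X Y) (hX : X.card + 1 = n) (hkn : k ≤ n)
    {S T : Finset V} (hSX : S ⊆ X) (hTY : T ⊆ Y) (hS : S.card = k) (hT : T.card = n - k)
    (hST : ∀ x ∈ S, ∀ y ∈ T, ¬ G.Adj x y) (hSY : ∀ x ∈ S, ∀ y ∈ Y, y ∉ T → G.Adj x y)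
    (hXT : ∀ x ∈ X, x ∉ S → ∀ y ∈ T, G.Adj x y) : MemC n k G X := by
  have hY := hG.card_add_one
  have hS' : (X \ S).card = n - k - 1 := by
    rw [Finset.card_sdiff_of_subset hSX]
    omega
  have hT' : (Y \ T).card = k := by
    rw [Finset.card_sdiff_of_subset hTY]
    omega
  let e₁ : Fin k ≃ S := (S.equivFinOfCardEq hS).symm
  let e₂ : Fin (n - k) ≃ T := (T.equivFinOfCardEq hT).symm
  let e₃ : Fin (n - k - 1) ≃ (X \ S : Finset V) := ((X \ S).equivFinOfCardEq hS').symm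
  let e₄ : Fin k ≃ (Y \ T : Finset V) := ((Y \ T).equivFinOfCardEq hT').symm
  have m₁ : ∀ i, (e₁ i : V) ∈ S := fun i => (e₁ i).2
  have m₂ : ∀ i, (e₂ i : V) ∈ T := fun i => (e₂ i).2
  have m₃ : ∀ i, (e₃ i : V) ∈ X ∧ (e₃ i : V) ∉ S := fun i => Finset.mem_sdiff.1 (e₃ i).2
  have m₄ : ∀ i, (e₄ i : V) ∈ Y ∧ (e₄ i : V) ∉ T := fun i => Finset.mem_sdiff.1 (e₄ i).2
  have hXX : ∀ x ∈ X, ∀ y ∈ X, ¬ G.Adj x y := fun x hx y hy hxy =>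
    Finset.disjoint_left.1 hG.disjoint hy (hG.isBipartiteWith.mem_of_mem_adj hx hxy)
  have hYY : ∀ x ∈ Y, ∀ y ∈ Y, ¬ G.Adj x y := fun x hx y hy hxy =>
    Finset.disjoint_right.1 hG.disjoint hy (hG.isBipartiteWith.symm.mem_of_mem_adj hx hxy)
  have hne : ∀ x ∈ X, ∀ y ∈ Y, x ≠ y := fun x hx y hy hxy =>
    Finset.disjoint_left.1 hG.disjoint hx (hxy ▸ hy)
  let ψ : (Fin k ⊕ Fin (n - k)) ⊕ (Fin (n - k - 1) ⊕ Fin k) → V :=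
    Sum.elim (Sum.elim (fun i => (e₁ i : V)) fun i => (e₂ i : V))
      (Sum.elim (fun i => (e₃ i : V)) fun i => (e₄ i : V))
  have hψ : Function.Bijective ψ := by
    constructor
    · refine Function.Injective.sumElim (Function.Injective.sumElim ?_ ?_ ?_)
        (Function.Injective.sumElim ?_ ?_ ?_) ?_
      · exact Subtype.val_injective.comp e₁.injective
      · exact Subtype.val_injective.comp e₂.injective
      · exact fun i j => hne _ (hSX (m₁ i)) _ (hTY (m₂ j))
      · exact Subtype.val_injective.comp e₃.injective
      · exact Subtype.val_injective.comp e₄.injective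
      · exact fun i j => hne _ (m₃ i).1 _ (m₄ j).1
      · rintro (i | i) (j | j)
        · exact fun h => (m₃ j).2 ((show (e₁ i : V) = e₃ j from h) ▸ m₁ i)
        · exact hne _ (hSX (m₁ i)) _ (m₄ j).1
        · exact (hne _ (m₃ j).1 _ (hTY (m₂ i))).symm
        · exact fun h => (m₄ j).2 ((show (e₂ i : V) = e₄ j from h) ▸ m₂ i)
    · intro v
      by_cases hvX : v ∈ X
      · by_cases hvS : v ∈ S
        · exact ⟨.inl (.inl (e₁.symm ⟨v, hvS⟩)), by simp [ψ]⟩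
        · exact ⟨.inr (.inl (e₃.symm ⟨v, Finset.mem_sdiff.2 ⟨hvX, hvS⟩⟩)), by simp [ψ]⟩
      · have hvY := (hG.mem_or_mem v).resolve_left hvX
        by_cases hvT : v ∈ T
        · exact ⟨.inl (.inr (e₂.symm ⟨v, hvT⟩)), by simp [ψ]⟩
        · exact ⟨.inr (.inr (e₄.symm ⟨v, Finset.mem_sdiff.2 ⟨hvY, hvT⟩⟩)), by simp [ψ]⟩
  let H : SimpleGraph (Fin (n - k - 1) ⊕ Fin k) := G.comap fun s => ψ (.inr s)
  let φ : sqcup (⊥ : SimpleGraph (Fin k ⊕ Fin (n - k))) H ≃g G :=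
    { toEquiv := Equiv.ofBijective ψ hψ
      map_rel_iff' := by
        rintro ((i | i) | (i | i)) ((j | j) | (j | j)) <;>
          simp only [Equiv.ofBijective_apply, ψ, Sum.elim_inl, Sum.elim_inr]
        · simpa [sqcup] using hXX _ (hSX (m₁ i)) _ (hSX (m₁ j))
        · simpa [sqcup] using hST _ (m₁ i) _ (m₂ j)
        · simpa [sqcup] using hXX _ (hSX (m₁ i)) _ (m₃ j).1
        · simpa [sqcup] using hSY _ (m₁ i) _ (m₄ j).1 (m₄ j).2
        · simpa [sqcup] using fun h => hST _ (m₁ j) _ (m₂ i) h.symm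
        · simpa [sqcup] using hYY _ (hTY (m₂ i)) _ (hTY (m₂ j))
        · simpa [sqcup] using (hXT _ (m₃ j).1 (m₃ j).2 _ (m₂ i)).symm
        · simpa [sqcup] using hYY _ (hTY (m₂ i)) _ (m₄ j).1
        · simpa [sqcup] using hXX _ (m₃ i).1 _ (hSX (m₁ j))
        · simpa [sqcup] using hXT _ (m₃ i).1 (m₃ i).2 _ (m₂ j)
        · simp [sqcup, H, ψ]
        · simp [sqcup, H, ψ]
        · simpa [sqcup] using (hSY _ (m₁ j) _ (m₄ i).1 (m₄ i).2).symm
        · simpa [sqcup] using hYY _ (m₄ i).1 _ (hTY (m₂ j))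
        · simp [sqcup, H, ψ]
        · simp [sqcup, H, ψ] }
  refine ⟨H, ?_, φ.symm, fun v => ?_⟩
  · rintro (i | i) (j | j) hij
    · exact absurd hij (hXX _ (m₃ i).1 _ (m₃ j).1)
    · simp
    · simp
    · exact absurd hij (hYY _ (m₄ i).1 _ (m₄ j).1)
  · obtain ⟨s, rfl⟩ := φ.surjective v
    rw [RelIso.symm_apply_apply]
    change ψ s ∈ X ↔ _
    rcases s with (i | i) | (i | i)
    · simpa [ψ, firstPart] using hSX (m₁ i)
    · simpa [ψ, firstPart] using Finset.disjoint_right.1 hG.disjoint (hTY (m₂ i))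
    · simpa [ψ, firstPart] using (m₃ i).1
    · simpa [ψ, firstPart] using Finset.disjoint_right.1 hG.disjoint (m₄ i).1

end NearlyBalanced

/-! ### The graph of non-edges of a maximal extension -/

namespace NearlyBalanced

open BipartiteHamilton

variable {V : Type*} {G : SimpleGraph V} {X Y : Finset V} {n : ℕ} {R : Option X → Y → Prop}

/-- The bipartite graph on `V` whose edges are the pairs `x ∈ X`, `y ∈ Y` that are not related by
`R`. -/
def nonEdgeGraph (R : Option X → Y → Prop) : SimpleGraph V :=
  SimpleGraph.fromRel fun u v => ∃ (hu : u ∈ X) (hv : v ∈ Y), ¬ R (some ⟨u, hu⟩) ⟨v, hv⟩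

theorem nonEdgeGraph_adj (hXY : Disjoint X Y) (x : X) (y : Y) :
    (nonEdgeGraph R).Adj x y ↔ ¬ R (some x) y := by
  rw [nonEdgeGraph, SimpleGraph.fromRel_adj]
  constructor
  · rintro ⟨-, ⟨hu, hv, h⟩ | ⟨hu, hv, h⟩⟩
    · exact h
    · exact absurd x.2 (Finset.disjoint_right.1 hXY hv)
  · intro h
    exact ⟨fun hxy => Finset.disjoint_left.1 hXY x.2 (hxy ▸ y.2), Or.inl ⟨x.2, y.2, h⟩⟩

theorem exists_of_nonEdgeGraph_adj {u v : V} (h : (nonEdgeGraph R).Adj u v) :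
    ∃ (x : X) (y : Y), ((u = x ∧ v = y) ∨ (u = y ∧ v = x)) ∧ ¬ R (some x) y := by
  rw [nonEdgeGraph, SimpleGraph.fromRel_adj] at h
  obtain ⟨-, ⟨hu, hv, h⟩ | ⟨hu, hv, h⟩⟩ := h
  · exact ⟨⟨u, hu⟩, ⟨v, hv⟩, Or.inl ⟨rfl, rfl⟩, h⟩
  · exact ⟨⟨v, hu⟩, ⟨u, hv⟩, Or.inr ⟨rfl, rfl⟩, h⟩

theorem nonEdgeGraph_le_quasiComplement (hle : extRel G X Y ≤ R) :
    nonEdgeGraph R ≤ quasiComplement G X Y := by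
  intro u v h
  have hne := h.ne
  obtain ⟨x, y, hxy, h⟩ := exists_of_nonEdgeGraph_adj h
  have hG : ¬ G.Adj x y := fun hG => h (hle (some x) y (by simpa [extRel] using hG))
  rw [quasiComplement, SimpleGraph.between_adj, SimpleGraph.compl_adj]
  obtain ⟨rfl, rfl⟩ | ⟨rfl, rfl⟩ := hxy
  · exact ⟨⟨hne, hG⟩, Or.inl ⟨x.2, y.2⟩⟩
  · exact ⟨⟨hne, fun hG' => hG hG'.symm⟩, Or.inr ⟨y.2, x.2⟩⟩

theorem degree_eq_ncard (K : SimpleGraph V) (v : V) [Fintype (K.neighborSet v)] :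
    K.degree v = (K.neighborSet v).ncard := by
  rw [Set.ncard_eq_toFinset_card', SimpleGraph.degree, SimpleGraph.neighborFinset]

theorem neighborSet_nonEdgeGraph_left (hXY : Disjoint X Y) (x : X) :
    (nonEdgeGraph R).neighborSet x = Subtype.val '' {y | ¬ R (some x) y} := by
  ext v
  constructor
  · intro h
    obtain ⟨x', y, ⟨h1, h2⟩ | ⟨h1, h2⟩, h3⟩ := exists_of_nonEdgeGraph_adj h
    · obtain rfl := Subtype.ext h1
      exact ⟨y, h3, h2.symm⟩
    · exact absurd (h1 ▸ y.2) (Finset.disjoint_left.1 hXY x.2)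
  · rintro ⟨y, h, rfl⟩
    exact (nonEdgeGraph_adj hXY x y).2 h

theorem neighborSet_nonEdgeGraph_right (hXY : Disjoint X Y) (y : Y) :
    (nonEdgeGraph R).neighborSet y = Subtype.val '' {x | ¬ R (some x) y} := by
  ext v
  constructor
  · intro h
    obtain ⟨x, y', ⟨h1, h2⟩ | ⟨h1, h2⟩, h3⟩ := exists_of_nonEdgeGraph_adj h
    · exact absurd (h1 ▸ x.2) (Finset.disjoint_right.1 hXY y.2)
    · obtain rfl := Subtype.ext h1
      exact ⟨x, h3, h2.symm⟩
  · rintro ⟨x, h, rfl⟩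
    exact ((nonEdgeGraph_adj hXY x y).2 h).symm

theorem setOf_option_eq (hnone : ∀ y, R none y) (y : Y) :
    {a | R a y} = insert none (some '' {x | R (some x) y}) := by
  ext a
  cases a <;> simp [hnone]

theorem ncard_setOf_option (hnone : ∀ y, R none y) (y : Y) :
    {a | R a y}.ncard = {x | R (some x) y}.ncard + 1 := by
  rw [setOf_option_eq hnone, Set.ncard_insert_of_notMem (by simp),
    Set.ncard_image_of_injective _ (Option.some_injective _)]

theorem ncard_add_degree_left (hXY : Disjoint X Y) (hY : Y.card = n) (x : X)
    [Fintype ((nonEdgeGraph R).neighborSet (x : V))] :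
    {y | R (some x) y}.ncard + (nonEdgeGraph R).degree (x : V) = n := by
  rw [degree_eq_ncard, neighborSet_nonEdgeGraph_left hXY,
    Set.ncard_image_of_injective _ Subtype.val_injective]
  have := Set.ncard_add_ncard_compl {y | R (some x) y}
  rw [Nat.card_eq_fintype_card, Fintype.card_coe, hY] at this
  exact this

theorem ncard_add_degree_right (hXY : Disjoint X Y) (hX : X.card + 1 = n)
    (hnone : ∀ y, R none y) (y : Y) [Fintype ((nonEdgeGraph R).neighborSet (y : V))] :
    {a | R a y}.ncard + (nonEdgeGraph R).degree (y : V) = n := by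
  rw [degree_eq_ncard, neighborSet_nonEdgeGraph_right hXY,
    Set.ncard_image_of_injective _ Subtype.val_injective, ncard_setOf_option hnone]
  have := Set.ncard_add_ncard_compl {x | R (some x) y}
  rw [Nat.card_eq_fintype_card, Fintype.card_coe] at this
  change _ + {x | ¬ R (some x) y}.ncard = _ at this
  omega

variable [Fintype V] [DecidableEq V]

theorem IsNearlyBalanced.neighborSet_subset_left (hG : IsNearlyBalanced G X Y)
    (hle : extRel G X Y ≤ R) (x : X) : G.neighborSet x ⊆ Subtype.val '' {y | R (some x) y} := by
  intro v hv
  have hvY : v ∈ Y := hG.isBipartiteWith.mem_of_mem_adj x.2 hv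
  exact ⟨⟨v, hvY⟩, hle (some x) ⟨v, hvY⟩ (by simpa [extRel] using hv), rfl⟩

theorem IsNearlyBalanced.neighborSet_subset_right (hG : IsNearlyBalanced G X Y)
    (hle : extRel G X Y ≤ R) (y : Y) : G.neighborSet y ⊆ Subtype.val '' {x | R (some x) y} := by
  intro v hv
  have hvX : v ∈ X := hG.isBipartiteWith.symm.mem_of_mem_adj y.2 hv
  exact ⟨⟨v, hvX⟩, hle (some ⟨v, hvX⟩) y (by simpa [extRel] using hv.symm), rfl⟩

theorem IsNearlyBalanced.degree_le_left [DecidableRel G.Adj] (hG : IsNearlyBalanced G X Y)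
    (hle : extRel G X Y ≤ R) (x : X) : G.degree (x : V) ≤ {y | R (some x) y}.ncard := by
  rw [degree_eq_ncard, ← Set.ncard_image_of_injective _ Subtype.val_injective]
  exact Set.ncard_le_ncard (hG.neighborSet_subset_left hle x)

theorem IsNearlyBalanced.degree_le_right [DecidableRel G.Adj] (hG : IsNearlyBalanced G X Y)
    (hle : extRel G X Y ≤ R) (y : Y) : G.degree (y : V) ≤ {x | R (some x) y}.ncard := by
  rw [degree_eq_ncard, ← Set.ncard_image_of_injective _ Subtype.val_injective]
  exact Set.ncard_le_ncard (hG.neighborSet_subset_right hle y)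

theorem mul_sub_le_mul {a b k n : ℕ} (hab : n ≤ a + b) (ha : a + k ≤ n) (hka : k ≤ a) :
    k * (n - k) ≤ a * b := by
  obtain ⟨c, rfl⟩ := Nat.exists_eq_add_of_le hka
  obtain ⟨d, rfl⟩ := Nat.exists_eq_add_of_le ha
  rw [show k + c + k + d - k = k + c + d by omega]
  have : k + d ≤ b := by omega
  nlinarith [Nat.mul_le_mul_left (k + c) this]

theorem eq_of_mul_eq_mul_sub {a b k n : ℕ} (hab : n ≤ a + b) (ha : a + k ≤ n) (hka : k < a)
    (h : a * b = k * (n - k)) : a + k = n ∧ b = k := by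
  obtain ⟨c, rfl⟩ := Nat.exists_eq_add_of_lt hka
  obtain ⟨d, rfl⟩ := Nat.exists_eq_add_of_le ha
  obtain ⟨e, rfl⟩ := Nat.exists_eq_add_of_le (show k + d ≤ b by omega)
  rw [show k + c + 1 + k + d - k = k + c + 1 + d by omega] at h
  have h1 : d * (c + 1) + e * (k + c + 1) = 0 := by nlinarith
  have h2 : d = 0 := by
    have := Nat.eq_zero_of_add_eq_zero_right h1
    simpa using this
  have h3 : e = 0 := by
    have := Nat.eq_zero_of_add_eq_zero_left h1
    simpa using this
  omega

open Classical in
/-- If `R` is a maximal non-Hamiltonian relation above the balanced extension of `G` and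
`μ(Ĝ) ≤ √(k (n - k))`, then the graph of non-edges of `R` is biregular on its non-isolated
vertices, which are moreover not joined to isolated ones in the quasi-complement of `G`. -/
theorem degree_nonEdgeGraph [DecidableRel G.Adj] {k : ℕ} (hn : 2 ≤ n) (hk : k ≤ n)
    (hG : IsNearlyBalanced G X Y) (hX : X.card + 1 = n) (hdeg : k ≤ G.minDegree)
    (hmu : mu (quasiComplement G X Y) ≤ √((k : ℝ) * ((n : ℝ) - (k : ℝ))))
    (hle : extRel G X Y ≤ R)
    (hmax : Maximal (fun S : Option X → Y → Prop => ¬ Hamiltonian S n) R) :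
    (∀ (x : X) (y : Y), ¬ R (some x) y → 2 * k < n ∧
        (nonEdgeGraph R).degree (x : V) + k = n ∧ (nonEdgeGraph R).degree (y : V) = k) ∧
      ∀ u v : V, (quasiComplement G X Y).Adj u v →
        (nonEdgeGraph R).degree u = 0 → (nonEdgeGraph R).degree v = 0 := by
  have hXY := hG.disjoint
  have hY : Y.card = n := hG.card_add_one ▸ hX
  have hnone : ∀ y, R none y := fun y => hle none y (by simp [extRel])
  have hα : Nat.card (Option X) = n := by simp [hX]
  have hβ : Nat.card Y = n := by simp [hY]
  have hbounds : ∀ (x : X) (y : Y), ¬ R (some x) y →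
      n ≤ (nonEdgeGraph R).degree (x : V) + (nonEdgeGraph R).degree (y : V) ∧
      (nonEdgeGraph R).degree (x : V) + k ≤ n ∧ k < (nonEdgeGraph R).degree (x : V) := by
    intro x y hxy
    have h1 := ncard_add_ncard_le_of_maximal hn hα hβ hmax hxy
    have h2 := ncard_add_degree_left (R := R) hXY hY x
    have h3 := ncard_add_degree_right hXY hX hnone y
    have h4 := hG.degree_le_left hle x
    have h5 := hG.degree_le_right hle y
    have h6 := G.minDegree_le_degree x
    have h7 := G.minDegree_le_degree y
    have h8 := ncard_setOf_option hnone y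
    omega
  have hsq : √((k : ℝ) * ((n : ℝ) - (k : ℝ))) ^ 2 = ((k * (n - k) : ℕ) : ℝ) := by
    have hk' : (k : ℝ) ≤ n := by exact_mod_cast hk
    rw [Real.sq_sqrt (mul_nonneg (by positivity) (by linarith)), Nat.cast_mul, Nat.cast_sub hk]
  obtain ⟨h1, h2⟩ := degree_mul_degree_of_mu_le (nonEdgeGraph_le_quasiComplement hle) hmu
    (fun u v huv => by
      obtain ⟨x, y, hxy, h⟩ := exists_of_nonEdgeGraph_adj huv
      obtain ⟨b1, b2, b3⟩ := hbounds x y h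
      have := mul_sub_le_mul b1 b2 b3.le
      rw [hsq]
      obtain ⟨rfl, rfl⟩ | ⟨rfl, rfl⟩ := hxy
      · exact_mod_cast this
      · rw [mul_comm ((nonEdgeGraph R).degree _ : ℝ)]
        exact_mod_cast this)
  refine ⟨fun x y hxy => ?_, h2⟩
  obtain ⟨b1, b2, b3⟩ := hbounds x y hxy
  have h3 := h1 x y ((nonEdgeGraph_adj hXY x y).2 hxy)
  rw [hsq] at h3
  obtain ⟨h4, h5⟩ := eq_of_mul_eq_mul_sub b1 b2 b3 (by exact_mod_cast h3)
  exact ⟨by omega, h4, h5⟩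

open Classical in
/-- The non-edges of `R` join at most `k` vertices of `X` to `Y`, so biregularity makes them a
complete bipartite graph with parts of sizes `k` and `n - k`. Comparing degrees and
quasi-complements, `G` agrees with `R` except between the remaining vertices of `X` and `Y`. -/
theorem memC_of_maximal [DecidableRel G.Adj] {k : ℕ} (hk : 1 ≤ k) (hkn : 2 * k ≤ n)
    (hG : IsNearlyBalanced G X Y) (hX : X.card + 1 = n) (hdeg : k ≤ G.minDegree)
    (hmu : mu (quasiComplement G X Y) ≤ √((k : ℝ) * ((n : ℝ) - (k : ℝ))))
    (hle : extRel G X Y ≤ R)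
    (hmax : Maximal (fun S : Option X → Y → Prop => ¬ Hamiltonian S n) R) :
    MemC n k G X := by
  have hXY := hG.disjoint
  have hY : Y.card = n := hG.card_add_one ▸ hX
  have hnone : ∀ y, R none y := fun y => hle none y (by simp [extRel])
  have hα : Nat.card (Option X) = n := by simp [hX]
  have hβ : Nat.card Y = n := by simp [hY]
  obtain ⟨hK, hiso⟩ := degree_nonEdgeGraph (by omega) (by omega) hG hX hdeg hmu hle hmax
  obtain ⟨x₀, y₀, h₀⟩ : ∃ (x : X) (y : Y), ¬ R (some x) y := by
    by_contra! hall
    exact hmax.1 (hamiltonian_of_forall (by omega) hα hβ fun a b => by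
      cases a with
      | none => exact hnone b
      | some x => exact hall x b)
  obtain ⟨hkn', -, -⟩ := hK x₀ y₀ h₀
  -- the non-isolated vertices of the graph of non-edges
  set S : Finset X := Finset.univ.filter fun x => ∃ y, ¬ R (some x) y with hS
  set T : Finset Y := Finset.univ.filter fun y => ∃ x, ¬ R (some x) y with hT
  have hScard : S.card ≤ k := by
    have h := ncard_setOf_exists_not_adj_le (by omega) hkn' hα hβ hmax fun a b hab => by
      cases a with
      | none => exact absurd (hnone b) hab
      | some x =>
        obtain ⟨-, h2, h3⟩ := hK x b hab
        have h4 := ncard_add_degree_left (R := R) hXY hY x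
        have h5 := ncard_add_degree_right hXY hX hnone b
        omega
    have h' : {a | ∃ b, ¬ R a b} = some '' (S : Set X) := by
      ext a
      cases a <;> simp [hS, hnone]
    rwa [h', Set.ncard_image_of_injective _ (Option.some_injective _),
      Set.ncard_coe_finset] at h
  -- a vertex of `T` has `k` neighbours in the graph of non-edges, all of them in `S`
  have hfull : S.card = k ∧ ∀ x ∈ S, ∀ y ∈ T, ¬ R (some x) y := by
    have key : ∀ y ∈ T, S.card = k ∧ ∀ x ∈ S, ¬ R (some x) y := by
      intro y hy
      obtain ⟨x, hx⟩ := (Finset.mem_filter.1 hy).2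
      obtain ⟨-, -, h3⟩ := hK x y hx
      rw [degree_eq_ncard, neighborSet_nonEdgeGraph_right hXY,
        Set.ncard_image_of_injective _ Subtype.val_injective] at h3
      have hsub : {x | ¬ R (some x) y} ⊆ (S : Set X) := fun x' hx' =>
        Finset.mem_coe.2 (Finset.mem_filter.2 ⟨Finset.mem_univ _, y, hx'⟩)
      have hcard := Set.ncard_le_ncard hsub
      rw [Set.ncard_coe_finset, h3] at hcard
      have heq := Set.eq_of_subset_of_ncard_le hsub (by rw [Set.ncard_coe_finset, h3]; exact hScard)
      refine ⟨le_antisymm hScard hcard, fun x' hx' => ?_⟩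
      have : x' ∈ {x | ¬ R (some x) y} := heq ▸ Finset.mem_coe.2 hx'
      exact this
    exact ⟨(key y₀ (Finset.mem_filter.2 ⟨Finset.mem_univ _, x₀, h₀⟩)).1,
      fun x hx y hy => (key y hy).2 x hx⟩
  obtain ⟨hSk, hST⟩ := hfull
  have hset : ∀ x ∈ S, {y | ¬ R (some x) y} = (T : Set Y) := by
    intro x hx
    ext y
    exact ⟨fun h => Finset.mem_coe.2 (Finset.mem_filter.2 ⟨Finset.mem_univ _, x, h⟩),
      fun h => hST x hx y h⟩
  have hTcard : T.card = n - k := by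
    obtain ⟨-, h2, -⟩ := hK x₀ y₀ h₀
    rw [degree_eq_ncard, neighborSet_nonEdgeGraph_left hXY,
      Set.ncard_image_of_injective _ Subtype.val_injective,
      hset x₀ (Finset.mem_filter.2 ⟨Finset.mem_univ _, y₀, h₀⟩), Set.ncard_coe_finset] at h2
    omega
  refine memC_of_subsets hG hX (by omega) (S := S.map (Function.Embedding.subtype _))
    (T := T.map (Function.Embedding.subtype _)) (Finset.map_subtype_subset S)
    (Finset.map_subtype_subset T) (by rw [Finset.card_map, hSk])
    (by rw [Finset.card_map, hTcard]) ?_ ?_ ?_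
  · simp only [Finset.mem_map, Function.Embedding.subtype_apply]
    rintro _ ⟨x, hx, rfl⟩ _ ⟨y, hy, rfl⟩ hxy
    exact hST x hx y hy (hle (some x) y (by simpa [extRel] using hxy))
  · -- `x` has degree `k` in `R` and at least `k` in `G`
    simp only [Finset.mem_map, Function.Embedding.subtype_apply]
    rintro _ ⟨x, hx, rfl⟩ y hy hyT
    have hRxy : R (some x) ⟨y, hy⟩ := by
      by_contra hxy
      exact hyT ⟨⟨y, hy⟩, Finset.mem_filter.2 ⟨Finset.mem_univ _, x, hxy⟩, rfl⟩
    obtain ⟨y', hxy'⟩ := (Finset.mem_filter.1 hx).2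
    obtain ⟨-, h2, -⟩ := hK x y' hxy'
    have h3 := ncard_add_degree_left (R := R) hXY hY x
    have h4 : k ≤ G.degree (x : V) := hdeg.trans (G.minDegree_le_degree _)
    have heq := Set.eq_of_subset_of_ncard_le (hG.neighborSet_subset_left hle x) (by
      rw [Set.ncard_image_of_injective _ Subtype.val_injective, ← degree_eq_ncard]
      omega)
    have : y ∈ G.neighborSet (x : V) := heq ▸ ⟨⟨y, hy⟩, hRxy, rfl⟩
    exact this
  · -- otherwise `x`, `y` would be adjacent in the quasi-complement
    simp only [Finset.mem_map, Function.Embedding.subtype_apply]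
    rintro x hx hxS _ ⟨y, hy, rfl⟩
    by_contra hxy
    have hadj : (quasiComplement G X Y).Adj x y := by
      rw [quasiComplement, SimpleGraph.between_adj, SimpleGraph.compl_adj]
      exact ⟨⟨fun h => Finset.disjoint_left.1 hXY hx (h ▸ y.2), hxy⟩, Or.inl ⟨hx, y.2⟩⟩
    have h0 := hiso x y hadj (by
      have hempty : {y | ¬ R (some ⟨x, hx⟩) y} = ∅ := by
        refine Set.eq_empty_of_forall_notMem fun y' hy' => hxS ⟨⟨x, hx⟩, ?_, rfl⟩
        exact Finset.mem_filter.2 ⟨Finset.mem_univ _, y', hy'⟩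
      have := neighborSet_nonEdgeGraph_left (R := R) hXY ⟨x, hx⟩
      rw [hempty, Set.image_empty] at this
      rw [degree_eq_ncard, this, Set.ncard_empty])
    obtain ⟨x', hx'⟩ := (Finset.mem_filter.1 hy).2
    obtain ⟨-, -, h3⟩ := hK x' y hx'
    omega

end NearlyBalanced

theorem theorem3p10 {V : Type*} [Fintype V] [DecidableEq V] (G : SimpleGraph V)
    [DecidableRel G.Adj] (X Y : Finset V) (k n : ℕ) (hk : 1 ≤ k) (hn : 2 * k ≤ n)
    (hG : NearlyBalanced.IsNearlyBalanced G X Y)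
    (hcard : Fintype.card V = 2 * n - 1)
    (hdeg : k ≤ G.minDegree)
    (hmu : NearlyBalanced.mu (NearlyBalanced.quasiComplement G X Y) ≤
      Real.sqrt ((k : ℝ) * ((n : ℝ) - (k : ℝ)))) :
    NearlyBalanced.Traceable G ∨
      (∃ j : ℕ, 1 ≤ j ∧ 2 * j ≤ n ∧ NearlyBalanced.MemC n j G X) ∨
      (∃ v : Fin 4 ⊕ Fin 4, NearlyBalanced.gamma2.degree v = 4 ∧
        Nonempty (G ≃g NearlyBalanced.gamma2.induce ({v}ᶜ : Set (Fin 4 ⊕ Fin 4)))) := by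
  by_cases hham : BipartiteHamilton.Hamiltonian (NearlyBalanced.extRel G X Y) n
  · exact Or.inl (hG.traceable hcard hham)
  -- the exceptional graph on seven vertices does not arise: its minimum degree is `1`, while the
  -- spectral radius of its quasi-complement is `2 > √3`
  · obtain ⟨R, hle, hmax⟩ := Finite.exists_le_maximal
      (p := fun S : Option X → Y → Prop => ¬ BipartiteHamilton.Hamiltonian S n) hham
    exact Or.inr (Or.inl ⟨k, hk, hn, NearlyBalanced.memC_of_maximal hk hn hG
      (hG.card_left hcard) hdeg hmu hle hmax⟩)
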